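/- Let $N=2^n$, and for $\boldsymbol\theta=(\theta_1,\dots,\theta_n)$ let $B(\boldsymbol\theta)=R_{\theta_n}\otimes\cdots\otimes R_{\theta_1}$, where $R_t=\begin{bmatrix}\cos t&\sin t\\-\sin t&\cos t\end{bmatrix}$, be the simple scalar butterfly matrix of order $N$; equivalently $B(\theta_1,\dots,\theta_k)=\begin{bmatrix}\cos\theta_k\,A&\sin\theta_k\,A\\-\sin\theta_k\,A&\cos\theta_k\,A\end{bmatrix}$ with $A=B(\theta_1,\dots,\theta_{k-1})$, starting from the $1\times1$ matrix $1$. Gaussian elimination on an $N\times N$ matrix $A=A^{(1)}$ produces matrices $A^{(1)},\dots,A^{(N)}$ and a factorization $PAQ=LU$ ($P,Q$ permutation matrices, $L$ unit lower triangular, $U=A^{(N)}$ upper triangular): at step $k$ a pivot in the rows and columns $\ge k$ of $A^{(k)}$ is moved to position $(k,k)$ by a row and a column transposition, and the entries below it are eliminated. The pivot is the $(k,k)$ entry (GENP, no pivoting); the first entry of maximal magnitude in column $k$ (GEPP, partial pivoting); the entry found by the rook search that starts with column $k$ and alternates column and row searches until the candidate is maximal in magnitude in both its row and its column (GERP); or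 the first entry, in column-major order, of maximal magnitude in the whole remaining block (GECP, complete pivoting). A matrix is completely pivoted if GECP moves no row or column. The growth factor is $\rho(A)=\max_k\|A^{(k)}\|_{\max}/\|A\|_{\max}$, with $\|C\|_{\max}=\max_{i,j}|C_{ij}|$. (1) Suppose that $\cos\theta_j\neq0$ for all $j$ and that $|\tan\theta_{j+1}|\le|\tan\theta_j|\le1$ for each $j$. Then the GENP, GEPP, GERP and GECP factorizations of $B(\boldsymbol\theta)$ exist and coincide, $B(\boldsymbol\theta)$ is completely pivoted, and for each of the four schemes $$\rho(B(\boldsymbol\theta))=\prod_{j=1}^n\min(|\sec\theta_j|,|\csc\theta_j|)^2=\prod_{j=1}^n\bigl(1+\min(|\tan\theta_j|,|\cot\theta_j|)^2\bigr),$$ where $|\csc\theta_j|=|\cot\theta_j|=\infty$ if $\sin\theta_j=0$. (2) Suppose that $\boldsymbol\theta\sim\operatorname{Uniform}([0,2\pi)^n)$ and that $\sigma\in S_n$ (depending on $\boldsymbol\theta$) is such that, almost surely, $\tilde\theta_j=\theta_{\sigma(j)}$ satisfies $$\min(|\tan\tilde\theta_{j+1}|,|\cot\tilde\theta_{j+1}|)\le\min(|\tan\tilde\theta_j|,|\cot\tilde\theta_j|)\quad\text{for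 each }j.$$ Then, almost surely, the GEPP, GERP and GECP factorizations of $B(\tilde{\boldsymbol\theta})$ exist and coincide; and for each of these three schemes $\rho(B(\tilde{\boldsymbol\theta}))$ has the distribution of $\prod_{j=1}^n(1+Y_j^2)$, where $Y_1,\dots,Y_n$ are iid with the law of $|X|$ conditioned on $|X|\le1$, $X$ standard Cauchy. -/

import Mathlib

open MeasureTheory ProbabilityTheory

noncomputable section

namespace Butterfly

/-- The simple scalar butterfly matrix `B(θ)` of order `N = 2 ^ n`, by the block recursion
`B = [C A, S A; -S A, C A]` with `(C, S) = (cos θ_k, sin θ_k) I_{2^(k-1)}` at recursive step `k` and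
`A` the butterfly matrix of the earlier angles. The last angle is the outermost one, that is,
`B(θ) = R_{θ_n} ⊗ ⋯ ⊗ R_{θ_1}` with `R_t = [cos t, sin t; -sin t, cos t]`. -/
def butterfly : (n : ℕ) → (Fin n → ℝ) → Matrix (Fin (2 ^ n)) (Fin (2 ^ n)) ℝ
  | 0, _ => 1
  | n + 1, θ =>
    let A := butterfly n (fun j => θ j.castSucc)
    let t := θ (Fin.last n)
    let e : Fin (2 ^ n) ⊕ Fin (2 ^ n) ≃ Fin (2 ^ (n + 1)) :=
      finSumFinEquiv.trans (finCongr (by rw [pow_succ, mul_two]))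
    Matrix.reindex e e (Matrix.fromBlocks
      (Real.cos t • A) (Real.sin t • A)
      (-Real.sin t • A) (Real.cos t • A))

section GaussianElimination

variable {N : ℕ}

theorem maximizers_nonempty (k : Fin N) (f : Fin N → ℝ) :
    ((Finset.Ici k).filter fun a => ∀ b ∈ Finset.Ici k, f b ≤ f a).Nonempty := by
  obtain ⟨a, ha, h⟩ := Finset.exists_max_image (Finset.Ici k) f ⟨k, by simp⟩
  exact ⟨a, Finset.mem_filter.2 ⟨ha, h⟩⟩

/-- The smallest index `a ≥ k` at which `f` is maximal among the indices `≥ k`. -/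
def firstArgmax (k : Fin N) (f : Fin N → ℝ) : Fin N :=
  ((Finset.Ici k).filter fun a => ∀ b ∈ Finset.Ici k, f b ≤ f a).min' (maximizers_nonempty k f)

/-- The four pivoting schemes: none, partial, rook and complete pivoting. -/
inductive Scheme
  | genp
  | gepp
  | gerp
  | gecp

/-- The rook search in the rows and columns `≥ k`, from the candidate `(i, j)`, which is maximal in
magnitude in its column: stop if it is also maximal in its row; otherwise go to the first maximal
entry of the row, stop if it is maximal in its column, and otherwise go on from the first maximal
entry of that column. The first argument bounds the number of rounds; as each round strictly
increases the magnitude of the candidate, `N * N` rounds never run out. -/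
def rookSearch (A : Matrix (Fin N) (Fin N) ℝ) (k : Fin N) :
    ℕ → Fin N → Fin N → Fin N × Fin N
  | 0, i, j => (i, j)
  | m + 1, i, j =>
    open Classical in
    if ∀ c, k ≤ c → |A i c| ≤ |A i j| then (i, j)
    else
      let j' := firstArgmax k fun c => |A i c|
      if ∀ r, k ≤ r → |A r j'| ≤ |A i j'| then (i, j')
      else rookSearch A k m (firstArgmax k fun r => |A r j'|) j'

/-- The position (row, column) of the pivot that a scheme selects in the untriangularized block
(rows and columns `≥ k`). Partial pivoting takes the first entry of maximal magnitude of the leading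
column; complete pivoting takes, in column-major order, the first entry of maximal magnitude of the
block: the first column that contains such an entry, and in it the first row. -/
def pivot (s : Scheme) (k : Fin N) (A : Matrix (Fin N) (Fin N) ℝ) : Fin N × Fin N :=
  match s with
  | .genp => (k, k)
  | .gepp => (firstArgmax k fun r => |A r k|, k)
  | .gerp => rookSearch A k (N * N) (firstArgmax k fun r => |A r k|) k
  | .gecp =>
    let j := firstArgmax k fun c => (Finset.Ici k).sup' ⟨k, by simp⟩ fun r => |A r c|
    (firstArgmax k fun r => |A r j|, j)

/-- The state of Gaussian elimination: the accumulated row and column permutation matrices, the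
multipliers found so far (strictly lower triangular), and the current matrix. -/
@[ext]
structure State (N : ℕ) where
  P : Matrix (Fin N) (Fin N) ℝ
  Q : Matrix (Fin N) (Fin N) ℝ
  M : Matrix (Fin N) (Fin N) ℝ
  A : Matrix (Fin N) (Fin N) ℝ

/-- One elimination step at column `k` with pivot position `p`: swap row `k` with row `p.1` and
column `k` with column `p.2`, then subtract multiples of row `k` from the rows below it, recording
the multipliers. -/
def step (k : Fin N) (p : Fin N × Fin N) (S : State N) : State N :=
  let A := S.A.submatrix (Equiv.swap k p.1) (Equiv.swap k p.2)
  let M := S.M.submatrix (Equiv.swap k p.1) id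
  let m : Fin N → ℝ := fun r => if k < r then A r k / A k k else 0
  { P := S.P.submatrix (Equiv.swap k p.1) id
    Q := S.Q.submatrix id (Equiv.swap k p.2)
    M := Matrix.of fun r c => if c = k then m r else M r c
    A := Matrix.of fun r c => A r c - m r * A k c }

/-- The state after `k` steps, so that `(run s A k).A` is the intermediate form `A^(k+1)`. -/
def run (s : Scheme) (A : Matrix (Fin N) (Fin N) ℝ) : ℕ → State N
  | 0 => { P := 1, Q := 1, M := 0, A := A }
  | k + 1 =>
    let S := run s A k
    if h : k < N then step ⟨k, h⟩ (pivot s ⟨k, h⟩ S.A) S else S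

/-- The four factors of a factorization `P A Q = L U`. -/
@[ext]
structure Factors (N : ℕ) where
  P : Matrix (Fin N) (Fin N) ℝ
  Q : Matrix (Fin N) (Fin N) ℝ
  L : Matrix (Fin N) (Fin N) ℝ
  U : Matrix (Fin N) (Fin N) ℝ

/-- The output of Gaussian elimination with a given scheme, after its `N - 1` steps. -/
def geFactorization (s : Scheme) (A : Matrix (Fin N) (Fin N) ℝ) : Factors N :=
  let S := run s A (N - 1)
  { P := S.P, Q := S.Q, L := 1 + S.M, U := S.A }

/-- The elimination did not break down: `P A Q = L U` with `L` unit lower triangular and `U` upper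
triangular. -/
def Factors.IsFactorizationOf (F : Factors N) (A : Matrix (Fin N) (Fin N) ℝ) : Prop :=
  F.P * A * F.Q = F.L * F.U ∧
    (∀ i, F.L i i = 1) ∧ (∀ i j, i < j → F.L i j = 0) ∧ (∀ i j, j < i → F.U i j = 0)

/-- Complete pivoting never moves a row or a column. -/
def CompletelyPivoted (A : Matrix (Fin N) (Fin N) ℝ) : Prop :=
  ∀ k : Fin N, pivot .gecp k (run .gecp A k).A = (k, k)

/-- The max-norm of a matrix. -/
def maxNorm (A : Matrix (Fin N) (Fin N) ℝ) : ℝ :=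
  ⨆ p : Fin N × Fin N, |A p.1 p.2|

/-- The growth factor `max_k ‖A^(k)‖_max / ‖A‖_max`. -/
def growthFactor (s : Scheme) (A : Matrix (Fin N) (Fin N) ℝ) : ℝ :=
  (⨆ k : Fin N, maxNorm (run s A k).A) / maxNorm A

end GaussianElimination

/-- The law of `|X|` conditioned on `|X| ≤ 1`, for `X` standard Cauchy. -/
def truncatedCauchy : Measure ℝ :=
  cond ((cauchyMeasure 0 1).map fun x => |x|) (Set.Iic 1)

/-- The law of `∏ j, (1 + Y_j ^ 2)` for `n` iid variables `Y_j` with law `truncatedCauchy`. -/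
def growthLaw (n : ℕ) : Measure ℝ :=
  (Measure.pi fun _ : Fin n => truncatedCauchy).map fun y => ∏ j, (1 + y j ^ 2)

end Butterfly

end

noncomputable section

namespace Butterfly

/-! ### Gaussian elimination whose pivots dominate their Schur complements -/

section Elimination

variable {N : ℕ}

/-! Write a butterfly matrix as nested blocks `[a A, b A; -ε b A, ε a A]` with `a² + b² = 1`. If `T`
is a Schur complement of `A`, the corresponding one of the large matrix has blocks `a T`, `b T`, `-ε
b T` and `(ε/a)(A - b² T)`; once `A` is exhausted, `(ε/a) A` remains and its elimination starts
again (`schur`, `schur_step`).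

The core is that each pivot `p` dominates its Schur complement (`abs_combination_le_pivot`). The
critical block is `ε a ((1 + τ) A - τ T)` with `τ = b²/a²`, so the induction must bound such
combinations by `p` as well. They are controlled as long as `τ` is at most `b²/a²` for every factor
of `A`, which is what the ordering of the angles provides.

With dominant pivots no scheme has a reason to move anything. If instead `|sin| > |cos|` in some
factors, exchanging the rows of those factors gives a row permutation of a dominant matrix
(`exists_perm_butterfly`); when the leading columns have strict maxima, the three pivoting schemes
undo it in the same way (`Reduced`). The growth is the last pivot `∏ |a|⁻¹` over the first, `∏ |a|`.

For the law, `min |tan| |cot|` has the symmetries of the octants of the circle, and `arctan` turns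
the Cauchy law into a uniform angle. The product over the factors is symmetric, so sorting does not
affect its law. -/

theorem firstArgmax_eq {k r : Fin N} {f : Fin N → ℝ} (hkr : k ≤ r)
    (hmax : ∀ i, k ≤ i → f i ≤ f r) (hfirst : ∀ i, k ≤ i → f r ≤ f i → r ≤ i) :
    firstArgmax k f = r := by
  unfold firstArgmax
  apply le_antisymm
  · apply Finset.min'_le
    simpa [hkr] using hmax
  · apply Finset.le_min'
    intro i hi
    simp only [Finset.mem_filter, Finset.mem_Ici] at hi
    exact hfirst i hi.1 (hi.2 r hkr)

/-- If the leading column of the untriangularized block contains an entry of maximal magnitude of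
the whole block, then partial, rook and complete pivoting all choose the first such entry. -/
theorem pivot_eq {s : Scheme} (hs : s ≠ .genp) {k r : Fin N} {A : Matrix (Fin N) (Fin N) ℝ}
    (hkr : k ≤ r) (hmax : ∀ i j, k ≤ i → k ≤ j → |A i j| ≤ |A r k|)
    (hfirst : ∀ i, k ≤ i → |A r k| ≤ |A i k| → r ≤ i) : pivot s k A = (r, k) := by
  have hcol : (firstArgmax k fun i => |A i k|) = r :=
    firstArgmax_eq hkr (fun i hi => hmax i k hi le_rfl) hfirst
  cases s with
  | genp => exact absurd rfl hs
  | gepp => simp only [pivot, hcol]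
  | gerp =>
    simp only [pivot, hcol]
    -- One round of the search suffices: the starting candidate already passes the row test.
    obtain ⟨m, hm⟩ : ∃ m, N * N = m + 1 :=
      Nat.exists_eq_succ_of_ne_zero (Nat.mul_pos k.pos k.pos).ne'
    rw [hm, rookSearch, if_pos (fun c hc => hmax r c hkr hc)]
  | gecp =>
    have hj : (firstArgmax k fun c =>
        (Finset.Ici k).sup' ⟨k, by simp⟩ fun r => |A r c|) = k := by
      refine firstArgmax_eq le_rfl (fun c hc => ?_) (fun i hi _ => hi)
      refine Finset.sup'_le _ _ fun i hi => ?_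
      exact (hmax i c (Finset.mem_Ici.1 hi) hc).trans
        (Finset.le_sup' (fun r => |A r k|) (Finset.mem_Ici.2 hkr))
    simp only [pivot, hj, hcol]

/-- Pivots need only be compared along the run of `s`, because inductively `s'` is in the same
state. -/
theorem run_congr {s s' : Scheme} {A : Matrix (Fin N) (Fin N) ℝ}
    (h : ∀ k : Fin N, pivot s k (run s A k).A = pivot s' k (run s A k).A) (k : ℕ) :
    run s A k = run s' A k := by
  induction k with
  | zero => rfl
  | succ k ih =>
    simp only [run]
    rw [← ih]
    split_ifs with hk
    · rw [← h ⟨k, hk⟩]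
    · rfl

/-- `T k` is the `k`-th Schur complement of `A`, padded by zeros: `A` minus the first `k` rank-one
terms of its `LU` factorization. The pivots do not vanish. -/
structure IsSchurSequence (A : Matrix (Fin N) (Fin N) ℝ) (T : ℕ → Matrix (Fin N) (Fin N) ℝ) :
    Prop where
  zero : T 0 = A
  pivot_ne : ∀ k : Fin N, T k k k ≠ 0
  succ : ∀ (k i j : Fin N), T (k + 1) i j = T k i j - T k i k * T k k j / T k k k

namespace IsSchurSequence

variable {A : Matrix (Fin N) (Fin N) ℝ} {T : ℕ → Matrix (Fin N) (Fin N) ℝ}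

theorem eq_zero (h : IsSchurSequence A T) (k : ℕ) (hk : k ≤ N) (i j : Fin N)
    (hij : (i : ℕ) < k ∨ (j : ℕ) < k) : T k i j = 0 := by
  induction k generalizing i j with
  | zero => omega
  | succ k ih =>
    have hk' : k < N := hk
    have hs := h.succ ⟨k, hk'⟩ i j
    have hp := h.pivot_ne ⟨k, hk'⟩
    simp only at hs hp
    rw [hs]
    rcases hij with hi | hj
    · rcases Nat.lt_succ_iff_lt_or_eq.1 hi with hi | hi
      · rw [ih hk'.le i j (.inl hi), ih hk'.le i _ (.inl hi)]; simp
      · have : i = ⟨k, hk'⟩ := Fin.ext hi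
        subst this
        field_simp; ring
    · rcases Nat.lt_succ_iff_lt_or_eq.1 hj with hj | hj
      · rw [ih hk'.le i j (.inr hj), ih hk'.le _ j (.inr hj)]; simp
      · have : j = ⟨k, hk'⟩ := Fin.ext hj
        subst this
        field_simp; ring

/-- The differences `T l - T (l + 1)` are the rank-one terms, and they telescope from `T 0 = A` to
`T N = 0`. -/
theorem sum_rank_one (h : IsSchurSequence A T) (i j : Fin N) :
    A i j = ∑ l : Fin N, T l i l * T l l j / T l l l := by
  have hN : T N i j = 0 := h.eq_zero N le_rfl i j (.inl i.2)
  have htel : ∑ l : Fin N, (T l i j - T (l + 1) i j) = T 0 i j - T N i j := by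
    rw [Fin.sum_univ_eq_sum_range (fun l => T l i j - T (l + 1) i j) N]
    exact Finset.sum_range_sub' (fun l => T l i j) N
  rw [hN, sub_zero, h.zero] at htel
  rw [← htel]
  refine Finset.sum_congr rfl fun l _ => ?_
  rw [h.succ]; ring

end IsSchurSequence

/-- A state of the elimination of the row permutation `A'` of `A`, after `k` steps without column
exchanges: up to the row permutation `π`, it is the state of the elimination of `A` without
pivoting. -/
structure Reduced (A A' : Matrix (Fin N) (Fin N) ℝ) (T : ℕ → Matrix (Fin N) (Fin N) ℝ)
    (k : ℕ) (π : Equiv.Perm (Fin N)) (S : State N) : Prop where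
  fix : ∀ r : Fin N, (r : ℕ) < k → π r = r
  P_mul : S.P * A' = A.submatrix π id
  Q_eq : S.Q = 1
  M_eq : ∀ r c, S.M r c = if (c : ℕ) < k ∧ c < π r then T c (π r) c / T c c c else 0
  A_eq : ∀ r c, S.A r c = T (min k (π r)) (π r) c

theorem le_perm_of_fix {k : ℕ} {π : Equiv.Perm (Fin N)}
    (h : ∀ r : Fin N, (r : ℕ) < k → π r = r) {r : Fin N} (hr : k ≤ (r : ℕ)) : k ≤ (π r : ℕ) := by
  by_contra hlt
  have := π.injective (h (π r) (not_le.1 hlt))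
  rw [this] at hlt
  exact hlt hr

namespace Reduced

variable {A A' : Matrix (Fin N) (Fin N) ℝ} {T : ℕ → Matrix (Fin N) (Fin N) ℝ}
  {π : Equiv.Perm (Fin N)} {S : State N}

theorem zero (hT : T 0 = A) (hA : A' = A.submatrix π id) :
    Reduced A A' T 0 π { P := 1, Q := 1, M := 0, A := A' } where
  fix := by simp
  P_mul := by simp [hA]
  Q_eq := rfl
  M_eq := by simp
  A_eq := by simp [hA, hT]

theorem A_eq_of_le {k : ℕ} (h : Reduced A A' T k π S) {r : Fin N} (hr : k ≤ (r : ℕ))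
    (c : Fin N) : S.A r c = T k (π r) c := by
  rw [h.A_eq, min_eq_left (le_perm_of_fix h.fix hr)]

/-- The pivot row `r` is the one that `π` sends to row `k` of `A`, so the exchange makes the
permutation fix `k` too. Rows beyond `k` advance to stage `k + 1`; the others stay frozen at the
stage of their own index, hence the `min` in `A_eq`. -/
theorem step (hT : IsSchurSequence A T) {k r : Fin N} (h : Reduced A A' T k π S)
    (hr : π r = k) :
    Reduced A A' T (k + 1) (π * Equiv.swap k r) (Butterfly.step k (r, k) S) := by
  have hfix : ∀ x : Fin N, (x : ℕ) < k + 1 → (π * Equiv.swap k r) x = x := by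
    intro x hx
    rw [Equiv.Perm.mul_apply]
    rcases Nat.lt_succ_iff_lt_or_eq.1 hx with hx | hx
    · have hxk : x ≠ k := by rintro rfl; exact lt_irrefl _ hx
      have hxr : x ≠ r := by
        rintro rfl
        exact hxk ((h.fix x hx).symm.trans hr)
      rw [Equiv.swap_apply_of_ne_of_ne hxk hxr, h.fix x hx]
    · obtain rfl : x = k := Fin.ext hx
      simp [hr]
  have hlt : ∀ x : Fin N, k < x ↔ k < (π * Equiv.swap k r) x := by
    intro x
    constructor
    · intro hx
      exact le_perm_of_fix hfix (Nat.succ_le_of_lt hx)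
    · intro hx
      by_contra hle
      have hle : (x : ℕ) < k + 1 := Nat.lt_succ_of_le (not_lt.1 hle)
      rw [hfix x hle] at hx
      exact absurd hx (not_lt.2 (Nat.lt_succ_iff.1 hle))
  have hkk : (π * Equiv.swap k r) k = k := hfix k (Nat.lt_succ_self _)
  have hA : ∀ x c, S.A (Equiv.swap k r x) c =
      T (min k ((π * Equiv.swap k r) x)) ((π * Equiv.swap k r) x) c := fun x c => h.A_eq _ _
  have hM : ∀ x c, S.M (Equiv.swap k r x) c =
      if (c : ℕ) < k ∧ c < (π * Equiv.swap k r) x then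
        T c ((π * Equiv.swap k r) x) c / T c c c else 0 := fun x c => h.M_eq _ _
  generalize hπ : π * Equiv.swap k r = π' at *
  refine ⟨hfix, ?_, ?_, ?_, ?_⟩
  · ext x c
    have := congrFun (congrFun h.P_mul (Equiv.swap k r x)) c
    simp only [Matrix.mul_apply, Matrix.submatrix_apply, id] at this
    simp [Butterfly.step, Matrix.mul_apply, this, ← hπ]
  · ext x c
    simp [Butterfly.step, h.Q_eq]
  · intro x c
    simp only [Butterfly.step, Matrix.of_apply, Matrix.submatrix_apply, Equiv.swap_self,
      Equiv.refl_apply, id]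
    by_cases hc : c = k
    · subst hc
      simp only [if_true, hA, hkk, min_self, ← hlt, Nat.lt_succ_self, true_and]
      split_ifs with hx
      · rw [min_eq_left (Fin.le_def.1 ((hlt x).1 hx).le)]
      · rfl
    · have : (c : ℕ) < k + 1 ↔ (c : ℕ) < k :=
        ⟨fun h => lt_of_le_of_ne (Nat.lt_succ_iff.1 h) (fun h => hc (Fin.ext h)), fun h => by omega⟩
      simp only [hc, if_false, hM, this]
  · intro x c
    simp only [Butterfly.step, Matrix.of_apply, Matrix.submatrix_apply, Equiv.swap_self,
      Equiv.refl_apply, hA, hkk, min_self]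
    by_cases hx : k < x
    · have hx' := (hlt x).1 hx
      rw [if_pos hx, min_eq_left (Fin.le_def.1 hx'.le), min_eq_left (Nat.succ_le_of_lt hx'),
        hT.succ]
      ring
    · have hx1 : (x : ℕ) < k + 1 := Nat.lt_succ_of_le (not_lt.1 hx)
      rw [if_neg hx, hfix x hx1, min_eq_right (Nat.lt_succ_iff.1 hx1), min_eq_right hx1.le]
      ring

theorem isFactorizationOf (hT : IsSchurSequence A T) (h : Reduced A A' T (N - 1) π S) :
    Factors.IsFactorizationOf { P := S.P, Q := S.Q, L := 1 + S.M, U := S.A } A' := by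
  -- A permutation that fixes all indices but the last fixes the last one as well, so `N - 1` steps
  -- suffice.
  have hπ : ∀ r, π r = r := by
    intro r
    by_cases hr : (r : ℕ) < N - 1
    · exact h.fix r hr
    · have h1 := le_perm_of_fix h.fix (not_lt.1 hr)
      have h2 := r.2
      have h3 := (π r).2
      exact Fin.ext (by omega)
  have hU : ∀ r c, S.A r c = T r r c := by
    intro r c
    rw [h.A_eq, hπ, min_eq_right (by omega)]
  have hM : ∀ r c, S.M r c = if c < r then T c r c / T c c c else 0 := by
    intro r c
    rw [h.M_eq, hπ]
    refine if_congr ⟨fun h => h.2, fun h => ⟨?_, h⟩⟩ rfl rfl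
    have := Fin.lt_def.1 h
    omega
  have hL : ∀ r c, (1 + S.M) r c = T c r c / T c c c := by
    intro r c
    rw [Matrix.add_apply, hM]
    rcases lt_trichotomy c r with hc | rfl | hc
    · rw [if_pos hc, Matrix.one_apply_ne hc.ne', zero_add]
    · simp [div_self (hT.pivot_ne c)]
    · rw [if_neg hc.not_gt, Matrix.one_apply_ne hc.ne, hT.eq_zero c c.2.le r c (.inl hc)]
      simp
  refine ⟨?_, ?_, ?_, ?_⟩
  · simp only [h.P_mul, h.Q_eq, Matrix.mul_one]
    ext i j
    rw [Matrix.submatrix_apply, hπ, id, hT.sum_rank_one, Matrix.mul_apply]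
    refine Finset.sum_congr rfl fun l _ => ?_
    rw [hL, hU]; ring
  · intro i
    simp only [hL, div_self (hT.pivot_ne i)]
  · intro i j hij
    simp only [hL, hT.eq_zero j j.2.le i j (.inl hij), zero_div]
  · intro i j hij
    simp only [hU, hT.eq_zero i i.2.le i j (.inr hij)]

/-- After a row permutation a tie in the leading column could be resolved in favour of a wrong row,
so strictness is needed there. Ties with other columns are harmless, as the leading column comes
first. -/
theorem pivot_eq_of_unique (h : ∀ k i j : Fin N, |T k i j| ≤ |T k k k|)
    (huniq : ∀ k i : Fin N, i ≠ k → |T k i k| < |T k k k|) {s : Scheme} (hs : s ≠ .genp)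
    {k : Fin N} (hS : Reduced A A' T k π S) : pivot s k S.A = (π.symm k, k) := by
  have hle : k ≤ π.symm k := by
    by_contra hlt
    have := hS.fix _ (not_le.1 hlt)
    rw [Equiv.apply_symm_apply] at this
    exact hlt this.le
  apply pivot_eq hs hle
  · intro i j hi _
    rw [hS.A_eq_of_le hi, hS.A_eq_of_le hle, Equiv.apply_symm_apply]
    exact h _ _ _
  · intro i hi hki
    rw [hS.A_eq_of_le hi, hS.A_eq_of_le hle, Equiv.apply_symm_apply] at hki
    by_contra hne
    have : π i ≠ k := by
      rintro rfl
      simp at hne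
    exact absurd hki (not_le.2 (huniq k _ this))

/-- Without a permutation the pivot sits at the first position of the block and wins every tie, so
weak dominance is enough. -/
theorem pivot_eq_self (h : ∀ k i j : Fin N, |T k i j| ≤ |T k k k|) (s : Scheme)
    {k : Fin N} (hS : Reduced A A' T k 1 S) : pivot s k S.A = (k, k) := by
  by_cases hs : s = .genp
  · rw [hs]; rfl
  · refine pivot_eq hs le_rfl (fun i j hi _ => ?_) (fun i hi _ => hi)
    rw [hS.A_eq_of_le hi, hS.A_eq_of_le le_rfl]
    exact h _ _ _

end Reduced

variable {A A' : Matrix (Fin N) (Fin N) ℝ} {T : ℕ → Matrix (Fin N) (Fin N) ℝ}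

theorem IsSchurSequence.reduced_run_one (hT : IsSchurSequence A T)
    (h : ∀ k i j : Fin N, |T k i j| ≤ |T k k k|) (s : Scheme) (k : ℕ) (hk : k ≤ N) :
    Reduced A A T k 1 (run s A k) := by
  induction k with
  | zero => exact Reduced.zero hT.zero (by simp)
  | succ k ih =>
    have hk' : k < N := hk
    have ih := ih hk'.le
    have hp := Reduced.pivot_eq_self h s (k := ⟨k, hk'⟩) ih
    simp only [run, dif_pos hk', hp]
    have hstep := Reduced.step hT (k := ⟨k, hk'⟩) (r := ⟨k, hk'⟩) ih rfl
    rwa [one_mul, Equiv.swap_self] at hstep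

theorem IsSchurSequence.reduced_run (hT : IsSchurSequence A T)
    (h : ∀ k i j : Fin N, |T k i j| ≤ |T k k k|)
    (huniq : ∀ k i : Fin N, i ≠ k → |T k i k| < |T k k k|) {s : Scheme} (hs : s ≠ .genp)
    {π₀ : Equiv.Perm (Fin N)} (hA : A' = A.submatrix π₀ id) (k : ℕ) (hk : k ≤ N) :
    ∃ π, Reduced A A' T k π (run s A' k) := by
  induction k with
  | zero => exact ⟨π₀, Reduced.zero hT.zero hA⟩
  | succ k ih =>
    have hk' : k < N := hk
    obtain ⟨π, ih⟩ := ih hk'.le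
    have hp := Reduced.pivot_eq_of_unique h huniq hs (k := ⟨k, hk'⟩) ih
    simp only [run, dif_pos hk', hp]
    exact ⟨_, Reduced.step hT (k := ⟨k, hk'⟩) ih (by simp)⟩

theorem le_maxNorm (B : Matrix (Fin N) (Fin N) ℝ) (i j : Fin N) : |B i j| ≤ maxNorm B :=
  le_ciSup (f := fun p : Fin N × Fin N => |B p.1 p.2|) (Set.finite_range _).bddAbove (i, j)

theorem maxNorm_eq {B : Matrix (Fin N) (Fin N) ℝ} {i j : Fin N}
    (h : ∀ r c, |B r c| ≤ |B i j|) : maxNorm B = |B i j| :=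
  have : Nonempty (Fin N × Fin N) := ⟨(i, j)⟩
  le_antisymm (ciSup_le fun p => h p.1 p.2) (le_maxNorm B i j)

/-- If the pivots of the Schur sequence of `A` dominate and the last one is the largest, then the
growth factor of a row permutation of `A` is the ratio of the last pivot to the first one. -/
theorem growthFactor_eq (hT : IsSchurSequence A T)
    (h : ∀ k i j : Fin N, |T k i j| ≤ |T k k k|) {s : Scheme}
    {π₀ : Equiv.Perm (Fin N)} (hA : A' = A.submatrix π₀ id)
    (hrun : ∀ k < N, ∃ π, Reduced A A' T k π (run s A' k))
    {z l : Fin N} (hz : (z : ℕ) = 0) (hl : (l : ℕ) + 1 = N)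
    (hlast : ∀ k : Fin N, |T k k k| ≤ |T l l l|) :
    growthFactor s A' = |T l l l| / |A z z| := by
  have hnorm : maxNorm A' = |A z z| := by
    have : |A z z| = |A' (π₀.symm z) z| := by simp [hA]
    rw [this]
    refine maxNorm_eq fun r c => ?_
    rw [← this, hA, Matrix.submatrix_apply, id, ← hT.zero]
    have := h z (π₀ r) c
    rwa [hz] at this
  have hle : ∀ k : Fin N, maxNorm (run s A' k).A ≤ |T l l l| := by
    intro k
    have : Nonempty (Fin N × Fin N) := ⟨(z, z)⟩
    obtain ⟨π, hπ⟩ := hrun k k.2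
    refine ciSup_le fun p => ?_
    rw [hπ.A_eq]
    -- Each row of an intermediate matrix belongs to some stage below `N`, whose pivot bounds it.
    have hm : min (k : ℕ) (π p.1) < N := lt_of_le_of_lt (min_le_left _ _) k.2
    exact (h ⟨_, hm⟩ _ _).trans (hlast ⟨_, hm⟩)
  have hge : |T l l l| ≤ maxNorm (run s A' l).A := by
    obtain ⟨π, hπ⟩ := hrun l l.2
    have hl' : π l = l := by
      have h1 := le_perm_of_fix hπ.fix (le_refl (l : ℕ))
      have h2 := (π l).2
      exact Fin.ext (by omega)
    have := le_maxNorm (run s A' l).A l l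
    rwa [hπ.A_eq, hl', min_self] at this
  have : Nonempty (Fin N) := ⟨z⟩
  rw [growthFactor, hnorm, le_antisymm (ciSup_le hle)
    (hge.trans (le_ciSup (f := fun k : Fin N => maxNorm (run s A' k).A)
      (Set.finite_range _).bddAbove l))]

end Elimination

/-! ### Schur complements of Kronecker products and dominance of their pivots -/

section SignedRotations

/-- The decomposition of `2 ^ (n + 1)` indices into a lower and an upper half. -/
def halves (n : ℕ) : Fin (2 ^ n) ⊕ Fin (2 ^ n) ≃ Fin (2 ^ (n + 1)) :=
  finSumFinEquiv.trans (finCongr (by rw [pow_succ, mul_two]))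

@[simp]
theorem halves_inl_val (n : ℕ) (i : Fin (2 ^ n)) : (halves n (.inl i) : ℕ) = i := by
  simp [halves]

@[simp]
theorem halves_inr_val (n : ℕ) (i : Fin (2 ^ n)) : (halves n (.inr i) : ℕ) = 2 ^ n + i := by
  simp [halves, add_comm]

theorem forall_halves {n : ℕ} {p : Fin (2 ^ (n + 1)) → Prop} :
    (∀ i, p i) ↔ (∀ i, p (halves n (.inl i))) ∧ ∀ i, p (halves n (.inr i)) := by
  rw [← (halves n).forall_congr_right, Sum.forall]

/-- The Kronecker product of the matrices `[a, b; -ε b, ε a]`, the last factor being the outermost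
one. -/
def signedKron : (n : ℕ) → (a b ε : Fin n → ℝ) → Matrix (Fin (2 ^ n)) (Fin (2 ^ n)) ℝ
  | 0, _, _, _ => 1
  | n + 1, a, b, ε =>
    let A := signedKron n (Fin.init a) (Fin.init b) (Fin.init ε)
    let a' := a (Fin.last n)
    let b' := b (Fin.last n)
    let ε' := ε (Fin.last n)
    Matrix.reindex (halves n) (halves n)
      (Matrix.fromBlocks (a' • A) (b' • A) (-(ε' * b') • A) ((ε' * a') • A))

/-- The Schur complements of `signedKron n a b ε`, padded by zeros. -/
def schur : (n : ℕ) → (a b ε : Fin n → ℝ) → ℕ → Matrix (Fin (2 ^ n)) (Fin (2 ^ n)) ℝ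
  | 0, _, _, _, k => if k = 0 then 1 else 0
  | n + 1, a, b, ε, k =>
    let A := signedKron n (Fin.init a) (Fin.init b) (Fin.init ε)
    let T := schur n (Fin.init a) (Fin.init b) (Fin.init ε)
    let a' := a (Fin.last n)
    let b' := b (Fin.last n)
    let ε' := ε (Fin.last n)
    Matrix.reindex (halves n) (halves n)
      (if k < 2 ^ n then
        Matrix.fromBlocks (a' • T k) (b' • T k) (-(ε' * b') • T k)
          ((ε' / a') • (A - b' ^ 2 • T k))
      else Matrix.fromBlocks 0 0 0 ((ε' / a') • T (k - 2 ^ n)))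

/-- The factors are orthogonal, with the larger entries on the diagonal, and the magnitudes of the
off-diagonal entries decrease. -/
structure IsOrdered {n : ℕ} (a b ε : Fin n → ℝ) : Prop where
  sq_add_sq : ∀ j, a j ^ 2 + b j ^ 2 = 1
  sq_le_sq : ∀ j, b j ^ 2 ≤ a j ^ 2
  abs_sign : ∀ j, |ε j| = 1
  antitone : ∀ i j, i ≤ j → b j ^ 2 ≤ b i ^ 2

namespace IsOrdered

variable {n : ℕ}

theorem castSucc {a b ε : Fin (n + 1) → ℝ} (h : IsOrdered a b ε) :
    IsOrdered (Fin.init a) (Fin.init b) (Fin.init ε) where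
  sq_add_sq _ := h.sq_add_sq _
  sq_le_sq _ := h.sq_le_sq _
  abs_sign _ := h.abs_sign _
  antitone _ _ hij := h.antitone _ _ (Fin.castSucc_le_castSucc_iff.2 hij)

theorem ne_zero {a b ε : Fin n → ℝ} (h : IsOrdered a b ε) (j : Fin n) : a j ≠ 0 := by
  intro h0
  have h1 := h.sq_add_sq j
  have h2 := h.sq_le_sq j
  rw [h0] at h1 h2
  nlinarith

theorem abs_le_abs {a b ε : Fin n → ℝ} (h : IsOrdered a b ε) (j : Fin n) : |b j| ≤ |a j| :=
  _root_.sq_le_sq.1 (h.sq_le_sq j)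

end IsOrdered

theorem schur_zero (n : ℕ) {a b ε : Fin n → ℝ} (h : IsOrdered a b ε) :
    schur n a b ε 0 = signedKron n a b ε := by
  induction n with
  | zero => rfl
  | succ n ih =>
    have ha := h.ne_zero (Fin.last n)
    have hab := h.sq_add_sq (Fin.last n)
    simp only [schur, signedKron, ih h.castSucc]
    rw [if_pos (by positivity)]
    congr 2
    ext i j
    simp only [Matrix.smul_apply, Matrix.sub_apply, smul_eq_mul]
    field_simp
    linear_combination
      (-ε (Fin.last n) * signedKron n (Fin.init a) (Fin.init b) (Fin.init ε) i j) * hab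

theorem schur_eq_zero (n : ℕ) (a b ε : Fin n → ℝ) (k : ℕ) (hk : 2 ^ n ≤ k) :
    schur n a b ε k = 0 := by
  induction n generalizing k with
  | zero => simp only [schur]; rw [if_neg (by simp at hk; omega)]
  | succ n ih =>
    rw [pow_succ] at hk
    simp only [schur]
    rw [if_neg (by omega), ih _ _ _ _ (by omega)]
    simp

variable {n : ℕ} {a b ε : Fin (n + 1) → ℝ}

/-- The two branches of `schur` agree at `k = 2 ^ n`, where the inner complement vanishes. The step
that leaves the upper half thus needs no separate treatment. -/
theorem schur_succ_of_le (h : IsOrdered a b ε) (k : ℕ) (hk : k ≤ 2 ^ n) :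
    schur (n + 1) a b ε k = Matrix.reindex (halves n) (halves n)
      (Matrix.fromBlocks (a (Fin.last n) • schur n (Fin.init a) (Fin.init b) (Fin.init ε) k)
        (b (Fin.last n) • schur n (Fin.init a) (Fin.init b) (Fin.init ε) k)
        (-(ε (Fin.last n) * b (Fin.last n)) •
          schur n (Fin.init a) (Fin.init b) (Fin.init ε) k)
        ((ε (Fin.last n) / a (Fin.last n)) •
          (signedKron n (Fin.init a) (Fin.init b) (Fin.init ε) -
            b (Fin.last n) ^ 2 • schur n (Fin.init a) (Fin.init b) (Fin.init ε) k))) := by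
  rcases hk.lt_or_eq with hk | rfl
  · simp only [schur, if_pos hk]
  · simp only [schur, lt_irrefl, if_false, Nat.sub_self]
    rw [schur_zero n h.castSucc, schur_eq_zero n _ _ _ _ le_rfl]
    simp

theorem schur_succ_of_ge (k : ℕ) :
    schur (n + 1) a b ε (2 ^ n + k) = Matrix.reindex (halves n) (halves n)
      (Matrix.fromBlocks 0 0 0 ((ε (Fin.last n) / a (Fin.last n)) •
        schur n (Fin.init a) (Fin.init b) (Fin.init ε) k)) := by
  simp only [schur]
  rw [if_neg (by omega), Nat.add_sub_cancel_left]

theorem signedKron_succ :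
    signedKron (n + 1) a b ε = Matrix.reindex (halves n) (halves n)
      (Matrix.fromBlocks (a (Fin.last n) • signedKron n (Fin.init a) (Fin.init b) (Fin.init ε))
        (b (Fin.last n) • signedKron n (Fin.init a) (Fin.init b) (Fin.init ε))
        (-(ε (Fin.last n) * b (Fin.last n)) •
          signedKron n (Fin.init a) (Fin.init b) (Fin.init ε))
        ((ε (Fin.last n) * a (Fin.last n)) •
          signedKron n (Fin.init a) (Fin.init b) (Fin.init ε))) := rfl

theorem schur_pivot_ne (n : ℕ) {a b ε : Fin n → ℝ} (h : IsOrdered a b ε) (k : Fin (2 ^ n)) :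
    schur n a b ε k k k ≠ 0 := by
  induction n with
  | zero => simp [schur]
  | succ n ih =>
    have ha := h.ne_zero (Fin.last n)
    have he : ε (Fin.last n) ≠ 0 := by
      intro h0
      have := h.abs_sign (Fin.last n)
      simp [h0] at this
    revert k
    rw [forall_halves]
    refine ⟨fun k => ?_, fun k => ?_⟩
    · rw [halves_inl_val, schur_succ_of_le h _ k.2.le]
      simp [ha, ih h.castSucc k]
    · rw [halves_inr_val, schur_succ_of_ge]
      simp [ha, he, ih h.castSucc k]

/-- For a pivot in the upper half, the rank-one update in each block is a multiple of the inner one,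
with factors `a`, `b`, `-ε b` and `-ε b²/a`. In the lower half it is the inner update scaled by
`ε/a`. -/
theorem schur_step (n : ℕ) {a b ε : Fin n → ℝ} (h : IsOrdered a b ε) (k i j : Fin (2 ^ n)) :
    schur n a b ε (k + 1) i j = schur n a b ε k i j -
      schur n a b ε k i k * schur n a b ε k k j / schur n a b ε k k k := by
  induction n with
  | zero =>
    have : Subsingleton (Fin (2 ^ 0)) := inferInstanceAs (Subsingleton (Fin 1))
    have hk : k = 0 := Subsingleton.elim _ _
    have hi : i = 0 := Subsingleton.elim _ _
    have hj : j = 0 := Subsingleton.elim _ _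
    subst hk hi hj
    simp [schur]
  | succ n ih =>
    have ha := h.ne_zero (Fin.last n)
    have he : ε (Fin.last n) ≠ 0 := by
      intro h0
      have := h.abs_sign (Fin.last n)
      simp [h0] at this
    revert k i j
    simp only [forall_halves]
    refine ⟨fun k => ?_, fun k => ?_⟩
    · have hp := schur_pivot_ne n h.castSucc k
      rw [halves_inl_val, schur_succ_of_le h _ k.2.le, schur_succ_of_le h _ k.2]
      refine ⟨fun i => ⟨fun j => ?_, fun j => ?_⟩, fun i => ⟨fun j => ?_, fun j => ?_⟩⟩ <;>
      · simp [ih h.castSucc k]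
        field_simp
        try ring
    · have hp := schur_pivot_ne n h.castSucc k
      rw [halves_inr_val, add_assoc, schur_succ_of_ge, schur_succ_of_ge]
      refine ⟨fun i => ⟨fun j => ?_, fun j => ?_⟩, fun i => ⟨fun j => ?_, fun j => ?_⟩⟩
      · simp
      · simp
      · simp
      · simp [ih h.castSucc k]
        field_simp

theorem isSchurSequence_schur (n : ℕ) {a b ε : Fin n → ℝ} (h : IsOrdered a b ε) :
    IsSchurSequence (signedKron n a b ε) (schur n a b ε) :=
  ⟨schur_zero n h, schur_pivot_ne n h, schur_step n h⟩

theorem abs_le_of_convex {x y p s t : ℝ} (hx : |x| ≤ p) (hy : |y| ≤ p) (hst : |s| + |t| ≤ 1) :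
    |s * x + t * y| ≤ p := by
  have hp : 0 ≤ p := (abs_nonneg x).trans hx
  calc |s * x + t * y| ≤ |s| * |x| + |t| * |y| := by
        rw [← abs_mul, ← abs_mul]; exact abs_add_le _ _
    _ ≤ |s| * p + |t| * p := by gcongr
    _ = (|s| + |t|) * p := by ring
    _ ≤ 1 * p := by gcongr
    _ = p := one_mul p

/-- Every entry of the matrix, of its Schur complement, and of suitable affine combinations of them
is bounded by the pivot. The combinations with nonzero weight are what makes the induction on the
number of factors work. -/
theorem abs_combination_le_pivot (n : ℕ) {a b ε : Fin n → ℝ} (h : IsOrdered a b ε)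
    (k i j : Fin (2 ^ n)) :
    |schur n a b ε k i j| ≤ |schur n a b ε k k k| ∧
    ∀ τ, 0 ≤ τ → τ ≤ 1 → (∀ m, τ * a m ^ 2 ≤ b m ^ 2) →
      |(1 + τ) * signedKron n a b ε i j - τ * schur n a b ε k i j| ≤
        |schur n a b ε k k k| := by
  induction n with
  | zero =>
    have : Subsingleton (Fin (2 ^ 0)) := inferInstanceAs (Subsingleton (Fin 1))
    have hk : k = 0 := Subsingleton.elim _ _
    have hi : i = 0 := Subsingleton.elim _ _
    have hj : j = 0 := Subsingleton.elim _ _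
    subst hk hi hj
    simp [schur, signedKron]
  | succ n ih =>
    have ha := h.ne_zero (Fin.last n)
    have hba := h.abs_le_abs (Fin.last n)
    have he := h.abs_sign (Fin.last n)
    have hab := h.sq_add_sq (Fin.last n)
    have hle := h.sq_le_sq (Fin.last n)
    have hsq : 0 < a (Fin.last n) ^ 2 := by positivity
    have ih := ih h.castSucc
    -- The case `τ = 0`.
    have hx : ∀ k i j : Fin (2 ^ n), |signedKron n (Fin.init a) (Fin.init b) (Fin.init ε) i j| ≤
        |schur n (Fin.init a) (Fin.init b) (Fin.init ε) k k k| := by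
      intro k i j
      simpa using (ih k i j).2 0 le_rfl zero_le_one (fun m => by rw [zero_mul]; positivity)
    -- The case `τ = b²/a²` of the outermost factor, where `1 + τ = 1/a²`. It is admissible for the
    -- inner factors since their `b²` are at least as large: the ordering enters here.
    have hw : ∀ k i j : Fin (2 ^ n), |(signedKron n (Fin.init a) (Fin.init b) (Fin.init ε) i j -
        b (Fin.last n) ^ 2 * schur n (Fin.init a) (Fin.init b) (Fin.init ε) k i j) /
          a (Fin.last n) ^ 2| ≤
        |schur n (Fin.init a) (Fin.init b) (Fin.init ε) k k k| := by
      intro k i j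
      have hu : b (Fin.last n) ^ 2 / a (Fin.last n) ^ 2 ≤ 1 := (div_le_one hsq).2 hle
      refine le_of_eq_of_le (congrArg _ ?_) ((ih k i j).2
        (b (Fin.last n) ^ 2 / a (Fin.last n) ^ 2) (by positivity) hu fun m => ?_)
      · field_simp
        rw [hab, mul_one]
      · have h1 : b (Fin.last n) ^ 2 ≤ Fin.init b m ^ 2 := h.antitone _ _ (Fin.le_last _)
        have h2 : Fin.init a m ^ 2 + Fin.init b m ^ 2 = 1 := h.castSucc.sq_add_sq m
        calc _ ≤ b (Fin.last n) ^ 2 / a (Fin.last n) ^ 2 * a (Fin.last n) ^ 2 := by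
              exact mul_le_mul_of_nonneg_left (by linarith) (by positivity)
          _ = b (Fin.last n) ^ 2 := by field_simp
          _ ≤ _ := h1
    have hy := fun k i j => (ih k i j).1
    have hE := fun k i j τ h0 h1 (hτ : ∀ m, τ * a m ^ 2 ≤ b m ^ 2) =>
      (ih k i j).2 τ h0 h1 (fun m => hτ _)
    have hτ' : ∀ τ, (∀ m, τ * a m ^ 2 ≤ b m ^ 2) →
      τ * a (Fin.last n) ^ 2 ≤ b (Fin.last n) ^ 2 := fun τ hτ => hτ _
    have hmul : ∀ {c d z p : ℝ}, |c| ≤ |d| → |z| ≤ |p| → |c * z| ≤ |d * p| := by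
      intro c d z p hc hz
      rw [abs_mul, abs_mul]
      gcongr
    revert k i j
    simp only [forall_halves]
    refine ⟨fun k => ?_, fun k => ?_⟩
    · rw [halves_inl_val, schur_succ_of_le h _ k.2.le, signedKron_succ]
      simp only [Matrix.reindex_apply, Matrix.submatrix_apply, Equiv.symm_apply_apply,
        Matrix.fromBlocks_apply₁₁, Matrix.fromBlocks_apply₁₂, Matrix.fromBlocks_apply₂₁,
        Matrix.fromBlocks_apply₂₂, Matrix.smul_apply, Matrix.sub_apply, smul_eq_mul]
      have hx := hx k
      have hy := hy k
      have hw := hw k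
      have hE := hE k
      generalize schur n (Fin.init a) (Fin.init b) (Fin.init ε) k k k = p at *
      generalize schur n (Fin.init a) (Fin.init b) (Fin.init ε) k = T at *
      generalize signedKron n (Fin.init a) (Fin.init b) (Fin.init ε) = A at *
      generalize a (Fin.last n) = a' at *
      generalize b (Fin.last n) = b' at *
      generalize ε (Fin.last n) = ε' at *
      have heb : |-(ε' * b')| ≤ |a'| := by rwa [abs_neg, abs_mul, he, one_mul]
      have hea : |ε' * a'| ≤ |a'| := by rw [abs_mul, he, one_mul]
      refine ⟨fun i => ⟨fun j => ⟨hmul le_rfl (hy i j), fun τ h0 h1 hτ => ?_⟩,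
        fun j => ⟨hmul hba (hy i j), fun τ h0 h1 hτ => ?_⟩⟩,
        fun i => ⟨fun j => ⟨hmul heb (hy i j), fun τ h0 h1 hτ => ?_⟩,
        fun j => ⟨?_, fun τ h0 h1 hτ => ?_⟩⟩⟩
      · exact le_of_eq_of_le (congrArg _ (by ring)) (hmul le_rfl (hE i j τ h0 h1 hτ))
      · exact le_of_eq_of_le (congrArg _ (by ring)) (hmul hba (hE i j τ h0 h1 hτ))
      · exact le_of_eq_of_le (congrArg _ (by ring)) (hmul heb (hE i j τ h0 h1 hτ))
      · refine le_of_eq_of_le (congrArg _ ?_) (hmul hea (hw i j))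
        field_simp
      -- With `u = b²/a²`, the combination in the lower right block is `ε a ((1 - τ u) A + τ u T)`,
      -- a convex combination up to the factor `ε a`.
      · have hu : b' ^ 2 / a' ^ 2 ≤ 1 := (div_le_one hsq).2 hle
        have hu0 : 0 ≤ b' ^ 2 / a' ^ 2 := by positivity
        have hc : |1 - τ * (b' ^ 2 / a' ^ 2)| + |τ * (b' ^ 2 / a' ^ 2)| ≤ 1 := by
          rw [abs_of_nonneg (by nlinarith), abs_of_nonneg (by positivity)]
          linarith
        refine le_of_eq_of_le (congrArg _ ?_)
          (hmul hea (abs_le_of_convex (hx i j) (hy i j) hc))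
        field_simp
        linear_combination (ε' * τ * A i j) * hab
    · rw [halves_inr_val, schur_succ_of_ge, signedKron_succ]
      simp only [Matrix.reindex_apply, Matrix.submatrix_apply, Equiv.symm_apply_apply,
        Matrix.fromBlocks_apply₁₁, Matrix.fromBlocks_apply₁₂, Matrix.fromBlocks_apply₂₁,
        Matrix.fromBlocks_apply₂₂, Matrix.smul_apply, Matrix.zero_apply, smul_eq_mul, mul_zero,
        sub_zero, abs_zero, abs_nonneg, true_and]
      have hx := hx k
      have hy := hy k
      have hE := hE k
      generalize schur n (Fin.init a) (Fin.init b) (Fin.init ε) k k k = p at *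
      generalize schur n (Fin.init a) (Fin.init b) (Fin.init ε) k = T at *
      generalize signedKron n (Fin.init a) (Fin.init b) (Fin.init ε) = A at *
      generalize a (Fin.last n) = a' at *
      generalize b (Fin.last n) = b' at *
      generalize ε (Fin.last n) = ε' at *
      -- In the other three blocks the complement is zero, and `(1 + τ) a² ≤ a² + b² = 1` bounds
      -- what remains by the pivot `ε p/a`.
      have hout : ∀ τ, 0 ≤ τ → (∀ m, τ * a m ^ 2 ≤ b m ^ 2) → ∀ c x : ℝ, |c| ≤ |a'| →
          |x| ≤ |p| → |(1 + τ) * (c * x)| ≤ |ε' / a' * p| := by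
        intro τ h0 hτ c x hc hxp
        have := hτ' τ hτ
        refine le_of_eq_of_le (congrArg _ (by ring)) (hmul (c := (1 + τ) * c) ?_ hxp)
        rw [abs_div, he, abs_mul, abs_of_nonneg (by positivity : 0 ≤ 1 + τ),
          le_div_iff₀ (abs_pos.2 ha)]
        calc (1 + τ) * |c| * |a'| ≤ (1 + τ) * |a'| * |a'| := by gcongr
          _ = (1 + τ) * a' ^ 2 := by rw [mul_assoc, abs_mul_abs_self]; ring
          _ ≤ 1 := by linarith
      refine ⟨fun i => ⟨fun j τ h0 h1 hτ => hout τ h0 hτ _ _ le_rfl (hx i j),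
        fun j τ h0 h1 hτ => hout τ h0 hτ _ _ hba (hx i j)⟩,
        fun i => ⟨fun j τ h0 h1 hτ => hout τ h0 hτ _ _ ?_ (hx i j),
        fun j => ⟨hmul le_rfl (hy i j), fun τ h0 h1 hτ => ?_⟩⟩⟩
      · rwa [abs_neg, abs_mul, he, one_mul]
      -- Here the combination is `(ε/a) (a² ((1 + τ) A - τ T) - τ (1 - a²) T)`; its inner weights
      -- have absolute sum at most one because `τ ≤ 1`.
      · have hc : |a' ^ 2| + |-(τ * (1 - a' ^ 2))| ≤ 1 := by
          have : 0 ≤ 1 - a' ^ 2 := by nlinarith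
          rw [abs_neg, abs_of_nonneg hsq.le, abs_of_nonneg (by positivity)]
          nlinarith
        refine le_of_eq_of_le (congrArg _ ?_)
          (hmul le_rfl (abs_le_of_convex (hE i j τ h0 h1 hτ) (hy i j) hc))
        field_simp
        ring

theorem abs_schur_le_pivot (n : ℕ) {a b ε : Fin n → ℝ} (h : IsOrdered a b ε)
    (k i j : Fin (2 ^ n)) : |schur n a b ε k i j| ≤ |schur n a b ε k k k| :=
  (abs_combination_le_pivot n h k i j).1

/-- The leading column of a Schur complement has no other entry as large as the pivot. -/
theorem abs_schur_lt_pivot (n : ℕ) {a b ε : Fin n → ℝ} (h : IsOrdered a b ε)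
    (hlt : ∀ j, |b j| < |a j|) (k i : Fin (2 ^ n)) (hik : i ≠ k) :
    |schur n a b ε k i k| < |schur n a b ε k k k| := by
  induction n with
  | zero =>
    have : Subsingleton (Fin (2 ^ 0)) := inferInstanceAs (Subsingleton (Fin 1))
    exact absurd (Subsingleton.elim _ _) hik
  | succ n ih =>
    have ha := h.ne_zero (Fin.last n)
    have he := h.abs_sign (Fin.last n)
    have hb := hlt (Fin.last n)
    have ih := ih h.castSucc (fun j => hlt _)
    revert k i
    simp only [forall_halves]
    refine ⟨fun k => ?_, fun k => ?_⟩
    · have hp := abs_pos.2 (schur_pivot_ne n h.castSucc k)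
      rw [halves_inl_val, schur_succ_of_le h _ k.2.le]
      refine ⟨fun i hik => ?_, fun i _ => ?_⟩
      · have hik : i ≠ k := by rintro rfl; exact hik rfl
        simpa [abs_mul, ha] using ih k i hik
      · simp only [Matrix.reindex_apply, Matrix.submatrix_apply, Equiv.symm_apply_apply,
          Matrix.fromBlocks_apply₁₁, Matrix.fromBlocks_apply₂₁, Matrix.smul_apply, smul_eq_mul,
          abs_mul, abs_neg, he, one_mul]
        calc _ ≤ |b (Fin.last n)| *
              |schur n (Fin.init a) (Fin.init b) (Fin.init ε) k k k| := by
              exact mul_le_mul_of_nonneg_left (abs_schur_le_pivot n h.castSucc k i k) (abs_nonneg _)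
          _ < _ := by gcongr
    · have hp := abs_pos.2 (schur_pivot_ne n h.castSucc k)
      rw [halves_inr_val, schur_succ_of_ge]
      refine ⟨fun i _ => ?_, fun i hik => ?_⟩
      · simp only [Matrix.reindex_apply, Matrix.submatrix_apply, Equiv.symm_apply_apply,
          Matrix.fromBlocks_apply₁₂, Matrix.fromBlocks_apply₂₂, Matrix.smul_apply, smul_eq_mul,
          abs_mul, abs_div, he, Matrix.zero_apply, abs_zero]
        have := abs_pos.2 ha
        positivity
      · have hik : i ≠ k := by rintro rfl; exact hik rfl
        have := abs_pos.2 ha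
        simpa [abs_mul, abs_div, he, this] using ih k i hik

/-- Each binary digit of `k` contributes `|a|` (upper half) or `|a|⁻¹` (lower half) to the pivot,
and `|a| ≤ 1`. -/
theorem abs_pivot_le (n : ℕ) {a b ε : Fin n → ℝ} (h : IsOrdered a b ε) (k : Fin (2 ^ n)) :
    |schur n a b ε k k k| ≤ ∏ j, |a j|⁻¹ := by
  induction n with
  | zero =>
    have : Subsingleton (Fin (2 ^ 0)) := inferInstanceAs (Subsingleton (Fin 1))
    have hk : k = 0 := Subsingleton.elim _ _
    subst hk
    simp [schur]
  | succ n ih =>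
    have ha := abs_pos.2 (h.ne_zero (Fin.last n))
    have he := h.abs_sign (Fin.last n)
    have ha1 : |a (Fin.last n)| ≤ |a (Fin.last n)|⁻¹ := by
      have : |a (Fin.last n)| ≤ 1 := by
        rw [abs_le_one_iff_mul_self_le_one]
        nlinarith [h.sq_add_sq (Fin.last n)]
      exact this.trans (one_le_inv_iff₀.2 ⟨ha, this⟩)
    revert k
    rw [forall_halves]
    refine ⟨fun k => ?_, fun k => ?_⟩
    · rw [halves_inl_val, schur_succ_of_le h _ k.2.le, Fin.prod_univ_castSucc,
        mul_comm (Finset.prod _ _)]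
      simp only [Matrix.reindex_apply, Matrix.submatrix_apply, Equiv.symm_apply_apply,
          Matrix.fromBlocks_apply₁₁, Matrix.smul_apply, smul_eq_mul, abs_mul]
      exact mul_le_mul ha1 (ih h.castSucc k) (abs_nonneg _) (by positivity)
    · rw [halves_inr_val, schur_succ_of_ge, Fin.prod_univ_castSucc, mul_comm (Finset.prod _ _)]
      simp only [Matrix.reindex_apply, Matrix.submatrix_apply, Equiv.symm_apply_apply,
          Matrix.fromBlocks_apply₂₂, Matrix.smul_apply, smul_eq_mul, abs_mul, abs_div, he, one_div]
      exact mul_le_mul_of_nonneg_left (ih h.castSucc k) (by positivity)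

/-- The last index lies in the lower half at every level. -/
theorem abs_last_pivot (n : ℕ) {a b ε : Fin n → ℝ} (h : IsOrdered a b ε) (l : Fin (2 ^ n))
    (hl : (l : ℕ) + 1 = 2 ^ n) : |schur n a b ε l l l| = ∏ j, |a j|⁻¹ := by
  induction n with
  | zero =>
    have : Subsingleton (Fin (2 ^ 0)) := inferInstanceAs (Subsingleton (Fin 1))
    have hk : l = 0 := Subsingleton.elim _ _
    subst hk
    simp [schur]
  | succ n ih =>
    have he := h.abs_sign (Fin.last n)
    revert l
    rw [forall_halves]
    refine ⟨fun k hk => ?_, fun k hk => ?_⟩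
    · rw [halves_inl_val, pow_succ] at hk
      omega
    · rw [halves_inr_val, pow_succ] at hk
      rw [halves_inr_val, schur_succ_of_ge, Fin.prod_univ_castSucc, mul_comm (Finset.prod _ _)]
      simp only [Matrix.reindex_apply, Matrix.submatrix_apply, Equiv.symm_apply_apply,
          Matrix.fromBlocks_apply₂₂, Matrix.smul_apply, smul_eq_mul, abs_mul, abs_div, he, one_div]
      rw [ih h.castSucc k (by omega)]
      rfl

theorem abs_signedKron_zero (n : ℕ) (a b ε : Fin n → ℝ) (z : Fin (2 ^ n)) (hz : (z : ℕ) = 0) :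
    |signedKron n a b ε z z| = ∏ j, |a j| := by
  induction n with
  | zero => simp [signedKron]
  | succ n ih =>
    revert z
    rw [forall_halves]
    refine ⟨fun k hk => ?_, fun k hk => ?_⟩
    · rw [halves_inl_val] at hk
      rw [signedKron_succ, Fin.prod_univ_castSucc, mul_comm (Finset.prod _ _)]
      simp only [Matrix.reindex_apply, Matrix.submatrix_apply, Equiv.symm_apply_apply,
          Matrix.fromBlocks_apply₁₁, Matrix.smul_apply, smul_eq_mul, abs_mul]
      rw [ih _ _ _ k hk]
      rfl
    · rw [halves_inr_val] at hk
      have : 0 < 2 ^ n := by positivity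
      omega

end SignedRotations

/-! ### Pivoting and growth factors of butterfly matrices -/

section Growth

theorem butterfly_eq_signedKron (n : ℕ) (θ : Fin n → ℝ) :
    butterfly n θ = signedKron n (fun j => Real.cos (θ j)) (fun j => Real.sin (θ j)) 1 := by
  induction n with
  | zero => rfl
  | succ n ih =>
    simp only [butterfly, signedKron, ih, Pi.one_apply, one_mul]
    rfl

/-- Exchanging the rows of some of the rotation factors permutes the rows of the butterfly matrix
and leaves a Kronecker product of matrices `[a, b; -ε b, ε a]`. -/
theorem exists_perm_butterfly (n : ℕ) (θ a b ε : Fin n → ℝ)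
    (h : ∀ j, (a j = Real.cos (θ j) ∧ b j = Real.sin (θ j) ∧ ε j = 1) ∨
      (a j = -Real.sin (θ j) ∧ b j = Real.cos (θ j) ∧ ε j = -1)) :
    ∃ π : Equiv.Perm (Fin (2 ^ n)), butterfly n θ = (signedKron n a b ε).submatrix π id := by
  induction n with
  | zero => exact ⟨1, rfl⟩
  | succ n ih =>
    obtain ⟨π, hπ⟩ := ih (fun j => θ j.castSucc) (Fin.init a) (Fin.init b) (Fin.init ε)
      (fun j => h _)
    have hB : butterfly (n + 1) θ = Matrix.reindex (halves n) (halves n) (Matrix.fromBlocks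
      (Real.cos (θ (Fin.last n)) • butterfly n (fun j => θ j.castSucc))
      (Real.sin (θ (Fin.last n)) • butterfly n (fun j => θ j.castSucc))
      (-Real.sin (θ (Fin.last n)) • butterfly n (fun j => θ j.castSucc))
      (Real.cos (θ (Fin.last n)) • butterfly n (fun j => θ j.castSucc))) := rfl
    rw [hB, hπ]
    rcases h (Fin.last n) with ⟨ha, hb, he⟩ | ⟨ha, hb, he⟩
    · refine ⟨(halves n).permCongr (Equiv.sumCongr π π), ?_⟩
      ext i j
      revert i j
      simp only [forall_halves]
      simp [signedKron_succ, ha, hb, he, Equiv.permCongr_apply]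
    -- Exchanging the rows of `[cos, sin; -sin, cos]` gives `[-sin, cos; cos, sin]`, which is `[a,
    -- b; -ε b, ε a]` with `ε = -1`.
    · refine ⟨(halves n).permCongr ((Equiv.sumCongr π π).trans (Equiv.sumComm _ _)), ?_⟩
      ext i j
      revert i j
      simp only [forall_halves]
      simp [signedKron_succ, ha, hb, he, Equiv.permCongr_apply]

theorem growthFactor_eq_prod {n : ℕ} {a b ε : Fin n → ℝ} (h : IsOrdered a b ε) {s : Scheme}
    {B : Matrix (Fin (2 ^ n)) (Fin (2 ^ n)) ℝ} {π₀ : Equiv.Perm (Fin (2 ^ n))}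
    (hB : B = (signedKron n a b ε).submatrix π₀ id)
    (hrun : ∀ k < 2 ^ n, ∃ π, Reduced (signedKron n a b ε) B (schur n a b ε) k π (run s B k)) :
    growthFactor s B = ∏ j, (a j ^ 2)⁻¹ := by
  have hN : 0 < 2 ^ n := by positivity
  have hl : 2 ^ n - 1 + 1 = 2 ^ n := by omega
  have hlast := abs_last_pivot n h ⟨2 ^ n - 1, by omega⟩ hl
  rw [growthFactor_eq (isSchurSequence_schur n h) (abs_schur_le_pivot n h) hB hrun
    (z := ⟨0, hN⟩) (l := ⟨2 ^ n - 1, by omega⟩) rfl hl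
    (fun k => hlast ▸ abs_pivot_le n h k), hlast,
    abs_signedKron_zero n a b ε _ rfl, ← Finset.prod_div_distrib]
  refine Finset.prod_congr rfl fun j _ => ?_
  rw [← sq_abs]
  have := abs_pos.2 (h.ne_zero j)
  field_simp

theorem min_tan_cot_of_le {t : ℝ} (hc : Real.cos t ≠ 0) (h : |Real.sin t| ≤ |Real.cos t|) :
    min |Real.tan t| |Real.cot t| = |Real.sin t| / |Real.cos t| := by
  have hc' := abs_pos.2 hc
  rw [Real.tan_eq_sin_div_cos, Real.cot_eq_cos_div_sin, abs_div, abs_div]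
  rcases eq_or_ne (Real.sin t) 0 with hs | hs
  -- Here `Real.cot t` is `0` instead of infinite, but the minimum is unaffected because `Real.tan
  -- t` is `0` too.
  · simp [hs]
  · have hs' := abs_pos.2 hs
    exact min_eq_left (((div_le_one hc').2 h).trans ((one_le_div hs').2 h))

theorem min_tan_cot_of_ge {t : ℝ} (hs : Real.sin t ≠ 0) (h : |Real.cos t| ≤ |Real.sin t|) :
    min |Real.tan t| |Real.cot t| = |Real.cos t| / |Real.sin t| := by
  have hs' := abs_pos.2 hs
  rw [Real.tan_eq_sin_div_cos, Real.cot_eq_cos_div_sin, abs_div, abs_div]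
  rcases eq_or_ne (Real.cos t) 0 with hc | hc
  · simp [hc]
  · have hc' := abs_pos.2 hc
    exact min_eq_right (((div_le_one hs').2 h).trans ((one_le_div hc').2 h))

/-- On the unit circle `b² = r²/(1 + r²)` with `r = |b|/|a|`, which increases with `r`. -/
theorem sq_le_sq_of_ratio_le {a b a' b' : ℝ} (h : a ^ 2 + b ^ 2 = 1) (h' : a' ^ 2 + b' ^ 2 = 1)
    (ha : a ≠ 0) (ha' : a' ≠ 0) (hle : |b'| / |a'| ≤ |b| / |a|) : b' ^ 2 ≤ b ^ 2 := by
  have hle := pow_le_pow_left₀ (by positivity) hle 2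
  rw [div_pow, div_pow, sq_abs, sq_abs, sq_abs, sq_abs,
    div_le_div_iff₀ (by positivity) (by positivity)] at hle
  nlinarith

theorem inv_sq_eq_one_add_ratio_sq {a b : ℝ} (h : a ^ 2 + b ^ 2 = 1) (ha : a ≠ 0) :
    (a ^ 2)⁻¹ = 1 + (|b| / |a|) ^ 2 := by
  rw [div_pow, sq_abs, sq_abs]
  field_simp
  linarith

section Tangents

variable {n : ℕ} {θ : Fin n → ℝ}

theorem abs_sin_le_abs_cos {t : ℝ} (hc : Real.cos t ≠ 0) (ht : |Real.tan t| ≤ 1) :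
    |Real.sin t| ≤ |Real.cos t| := by
  rwa [Real.tan_eq_sin_div_cos, abs_div, div_le_one (abs_pos.2 hc)] at ht

theorem isOrdered_cos_sin (hcos : ∀ j, Real.cos (θ j) ≠ 0) (htan : ∀ j, |Real.tan (θ j)| ≤ 1)
    (hanti : ∀ i j, i ≤ j → |Real.tan (θ j)| ≤ |Real.tan (θ i)|) :
    IsOrdered (fun j => Real.cos (θ j)) (fun j => Real.sin (θ j)) 1 where
  sq_add_sq j := Real.cos_sq_add_sin_sq _
  sq_le_sq j := sq_le_sq.2 (abs_sin_le_abs_cos (hcos j) (htan j))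
  abs_sign j := by simp
  antitone i j hij := by
    have := hanti i j hij
    rw [Real.tan_eq_sin_div_cos, Real.tan_eq_sin_div_cos, abs_div, abs_div] at this
    exact sq_le_sq_of_ratio_le (Real.cos_sq_add_sin_sq _) (Real.cos_sq_add_sin_sq _) (hcos i)
      (hcos j) this

theorem butterfly_completelyPivoted_and_growth (hcos : ∀ j, Real.cos (θ j) ≠ 0)
    (htan : ∀ j, |Real.tan (θ j)| ≤ 1)
    (hanti : ∀ i j, i ≤ j → |Real.tan (θ j)| ≤ |Real.tan (θ i)|) :
    (∀ s, geFactorization s (butterfly n θ) = geFactorization .genp (butterfly n θ)) ∧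
    (geFactorization .genp (butterfly n θ)).IsFactorizationOf (butterfly n θ) ∧
    CompletelyPivoted (butterfly n θ) ∧
    ∀ s, growthFactor s (butterfly n θ) = ∏ j, (Real.cos (θ j) ^ 2)⁻¹ := by
  have h := isOrdered_cos_sin hcos htan hanti
  have hT := isSchurSequence_schur n h
  have hle := abs_schur_le_pivot n h
  have hrun := fun s => hT.reduced_run_one hle s
  rw [butterfly_eq_signedKron]
  refine ⟨fun s => ?_, (hrun .genp _ (Nat.sub_le _ _)).isFactorizationOf hT, fun k => ?_,
    fun s => ?_⟩
  · have := run_congr (s := s) (s' := .genp) (fun k =>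
      ((hrun s k k.2.le).pivot_eq_self hle s).trans
        ((hrun s k k.2.le).pivot_eq_self hle .genp).symm) (2 ^ n - 1)
    simp only [geFactorization, this]
  · exact (hrun .gecp k k.2.le).pivot_eq_self hle .gecp
  · exact growthFactor_eq_prod h (π₀ := 1) (by simp) fun k hk => ⟨1, hrun s k hk.le⟩

theorem butterfly_pivoting_and_growth (hsin : ∀ j, Real.sin (θ j) ≠ 0)
    (hcos : ∀ j, Real.cos (θ j) ≠ 0) (hne : ∀ j, |Real.sin (θ j)| ≠ |Real.cos (θ j)|)
    (hanti : ∀ i j, i ≤ j → min |Real.tan (θ j)| |Real.cot (θ j)| ≤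
      min |Real.tan (θ i)| |Real.cot (θ i)|) :
    geFactorization .gepp (butterfly n θ) = geFactorization .gecp (butterfly n θ) ∧
    geFactorization .gerp (butterfly n θ) = geFactorization .gecp (butterfly n θ) ∧
    (geFactorization .gecp (butterfly n θ)).IsFactorizationOf (butterfly n θ) ∧
    ∀ s : Scheme, s ≠ .genp → growthFactor s (butterfly n θ) =
      ∏ j, (1 + min |Real.tan (θ j)| |Real.cot (θ j)| ^ 2) := by
  -- In each factor `a` is, up to sign, the larger of cosine and sine; then `|b|/|a|` is the
  -- quantity by which the angles are sorted.
  obtain ⟨a, b, ε, hab⟩ : ∃ a b ε : Fin n → ℝ, ∀ j,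
      ((a j = Real.cos (θ j) ∧ b j = Real.sin (θ j) ∧ ε j = 1) ∨
        (a j = -Real.sin (θ j) ∧ b j = Real.cos (θ j) ∧ ε j = -1)) ∧
      |b j| < |a j| ∧ a j ≠ 0 ∧ a j ^ 2 + b j ^ 2 = 1 ∧ |ε j| = 1 ∧
      min |Real.tan (θ j)| |Real.cot (θ j)| = |b j| / |a j| := by
    have : ∀ j, ∃ a b ε : ℝ,
      ((a = Real.cos (θ j) ∧ b = Real.sin (θ j) ∧ ε = 1) ∨
        (a = -Real.sin (θ j) ∧ b = Real.cos (θ j) ∧ ε = -1)) ∧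
      |b| < |a| ∧ a ≠ 0 ∧ a ^ 2 + b ^ 2 = 1 ∧ |ε| = 1 ∧
      min |Real.tan (θ j)| |Real.cot (θ j)| = |b| / |a| := by
      intro j
      rcases lt_or_gt_of_ne (hne j) with hlt | hlt
      · exact ⟨_, _, _, .inl ⟨rfl, rfl, rfl⟩, hlt, hcos j, Real.cos_sq_add_sin_sq _, by simp,
          min_tan_cot_of_le (hcos j) hlt.le⟩
      · refine ⟨_, _, _, .inr ⟨rfl, rfl, rfl⟩, by rwa [abs_neg], neg_ne_zero.2 (hsin j), ?_,
          by simp, ?_⟩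
        · rw [neg_sq, Real.sin_sq_add_cos_sq]
        · rw [abs_neg, min_tan_cot_of_ge (hsin j) hlt.le]
    choose a b ε h using this
    exact ⟨a, b, ε, h⟩
  choose hcase hlt ha hsq he hmin using hab
  have h : IsOrdered a b ε :=
    { sq_add_sq := hsq
      sq_le_sq := fun j => sq_le_sq.2 (hlt j).le
      abs_sign := he
      antitone := fun i j hij => by
        have := hanti i j hij
        rw [hmin, hmin] at this
        exact sq_le_sq_of_ratio_le (hsq i) (hsq j) (ha i) (ha j) this }
  obtain ⟨π₀, hB⟩ := exists_perm_butterfly n θ a b ε hcase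
  have hT := isSchurSequence_schur n h
  have hle := abs_schur_le_pivot n h
  have huniq := abs_schur_lt_pivot n h hlt
  have hrun := fun {s : Scheme} (hs : s ≠ .genp) => hT.reduced_run hle huniq hs hB
  have heq : ∀ s, s ≠ .genp →
      geFactorization s (butterfly n θ) = geFactorization .gecp (butterfly n θ) := by
    intro s hs
    have := run_congr (s := s) (s' := .gecp) (A := butterfly n θ) (fun k => by
      obtain ⟨π, hπ⟩ := hrun hs k k.2.le
      rw [hπ.pivot_eq_of_unique hle huniq hs, hπ.pivot_eq_of_unique hle huniq (by simp)])
      (2 ^ n - 1)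
    simp only [geFactorization, this]
  refine ⟨heq _ (by simp), heq _ (by simp), ?_, fun s hs => ?_⟩
  · obtain ⟨π, hπ⟩ := hrun (s := .gecp) (by simp) _ (Nat.sub_le _ 1)
    exact hπ.isFactorizationOf hT
  · rw [growthFactor_eq_prod h hB fun k hk => hrun hs k hk.le]
    refine Finset.prod_congr rfl fun j _ => ?_
    rw [inv_sq_eq_one_add_ratio_sq (hsq j) (ha j), hmin]

end Tangents

end Growth

/-! ### The law of the growth factor for uniform angles -/

section Law

/-- The Cauchy density is the derivative of `arctan` divided by `π`, so this is a change of
variables. -/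
theorem cauchyMeasure_zero_one_apply {S : Set ℝ} (hS : MeasurableSet S) :
    cauchyMeasure 0 1 S = ENNReal.ofReal Real.pi⁻¹ * volume (Real.arctan '' S) := by
  rw [cauchyMeasure_of_scale_ne_zero 0 one_ne_zero, withDensity_apply _ hS]
  have h := lintegral_image_eq_lintegral_abs_deriv_mul hS
    (fun x _ => (Real.hasDerivAt_arctan x).hasDerivWithinAt) Real.arctan_injective.injOn
    (fun _ => 1)
  rw [setLIntegral_one] at h
  rw [h, ← lintegral_const_mul _ (by fun_prop)]
  refine lintegral_congr fun x => ?_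
  rw [mul_one, ← ENNReal.ofReal_mul (by positivity), cauchyPDF, cauchyPDFReal_def,
    abs_of_nonneg (by positivity)]
  congr 1
  simp [add_comm]

theorem measurable_min_tan_cot : Measurable fun t => min |Real.tan t| |Real.cot t| := by
  simp only [Real.tan_eq_sin_div_cos, Real.cot_eq_cos_div_sin]
  fun_prop

theorem min_tan_cot_add_pi_div_two (t : ℝ) :
    min |Real.tan (t + Real.pi / 2)| |Real.cot (t + Real.pi / 2)| =
      min |Real.tan t| |Real.cot t| := by
  simp only [Real.tan_eq_sin_div_cos, Real.cot_eq_cos_div_sin, Real.sin_add_pi_div_two,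
    Real.cos_add_pi_div_two, div_neg, neg_div, abs_neg]
  exact min_comm _ _

theorem min_tan_cot_neg (t : ℝ) :
    min |Real.tan (-t)| |Real.cot (-t)| = min |Real.tan t| |Real.cot t| := by
  simp only [Real.tan_eq_sin_div_cos, Real.cot_eq_cos_div_sin, Real.sin_neg,
    Real.cos_neg, div_neg, neg_div, abs_neg]

theorem min_tan_cot_arctan {x : ℝ} (hx : |x| ≤ 1) :
    min |Real.tan (Real.arctan x)| |Real.cot (Real.arctan x)| = |x| := by
  have hc := (Real.cos_arctan_pos x).ne'
  rw [min_tan_cot_of_le hc (abs_sin_le_abs_cos hc (by rwa [Real.tan_arctan])), ← abs_div,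
    ← Real.tan_eq_sin_div_cos, Real.tan_arctan]

theorem arctan_image_abs_le_one (E : Set ℝ) :
    Real.arctan '' (fun x => |x|) ⁻¹' (Set.Iic 1 ∩ E) =
      Set.Icc (-(Real.pi / 4)) (Real.pi / 4) ∩ (fun t => min |Real.tan t| |Real.cot t|) ⁻¹' E := by
  have key : ∀ x, |x| ≤ 1 ↔ Real.arctan x ∈ Set.Icc (-(Real.pi / 4)) (Real.pi / 4) := by
    intro x
    rw [← Real.arctan_one, ← Real.arctan_neg, Set.mem_Icc, Real.arctan_strictMono.le_iff_le,
      Real.arctan_strictMono.le_iff_le, abs_le]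
  ext t
  constructor
  · rintro ⟨x, ⟨hx, hE⟩, rfl⟩
    refine ⟨(key x).1 hx, ?_⟩
    rw [Set.mem_preimage, min_tan_cot_arctan hx]
    exact hE
  · rintro ⟨ht, hE⟩
    have hpi := Real.pi_pos
    have harc : Real.arctan (Real.tan t) = t :=
      Real.arctan_tan (by linarith [ht.1]) (by linarith [ht.2])
    have hle : |Real.tan t| ≤ 1 := by rwa [key, harc]
    refine ⟨Real.tan t, ⟨hle, ?_⟩, harc⟩
    have := min_tan_cot_arctan hle
    rw [harc] at this
    rwa [Set.mem_preimage, this] at hE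

section Symmetry

variable {D : Set ℝ}

theorem volume_Ioc_inter_add (a b : ℝ) {c : ℝ} (hD : ∀ t, t + c ∈ D ↔ t ∈ D) :
    volume (Set.Ioc (a + c) (b + c) ∩ D) = volume (Set.Ioc a b ∩ D) := by
  rw [← measure_preimage_add_right volume c (Set.Ioc (a + c) (b + c) ∩ D)]
  congr 1
  ext t
  simp [hD]

theorem volume_Ioc_inter_neg (a b : ℝ) (hD : ∀ t, -t ∈ D ↔ t ∈ D) :
    volume (Set.Ioc (-b) (-a) ∩ D) = volume (Set.Ioc a b ∩ D) := by
  have h : volume (Set.Ioc (-b) (-a) ∩ D) = volume (Set.Ico a b ∩ D) := by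
    rw [← Measure.measure_preimage_neg volume (Set.Ioc (-b) (-a) ∩ D)]
    congr 1
    ext t
    simp [hD]
  rw [h]
  exact measure_congr (Ico_ae_eq_Ioc.inter (ae_eq_refl _))

theorem volume_Ioc_inter_split {a b c : ℝ} (hab : a ≤ b) (hbc : b ≤ c) (hD : MeasurableSet D) :
    volume (Set.Ioc a c ∩ D) = volume (Set.Ioc a b ∩ D) + volume (Set.Ioc b c ∩ D) := by
  rw [← Set.Ioc_union_Ioc_eq_Ioc hab hbc, Set.union_inter_distrib_right]
  refine measure_union ?_ (measurableSet_Ioc.inter hD)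
  exact (Set.Ioc_disjoint_Ioc_of_le le_rfl).mono Set.inter_subset_left Set.inter_subset_left

theorem volume_Icc_inter_eq_two_mul (hD : MeasurableSet D) (hneg : ∀ t, -t ∈ D ↔ t ∈ D) :
    volume (Set.Icc (-(Real.pi / 4)) (Real.pi / 4) ∩ D) =
      2 * volume (Set.Ioc 0 (Real.pi / 4) ∩ D) := by
  have hpi := Real.pi_pos
  rw [measure_congr (Ioc_ae_eq_Icc.symm.inter (ae_eq_refl D)),
    volume_Ioc_inter_split (b := 0) (by linarith) (by linarith) hD]
  have := volume_Ioc_inter_neg 0 (Real.pi / 4) hneg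
  rw [neg_zero] at this
  rw [this, two_mul]

theorem volume_Ico_inter_eq_eight_mul (hD : MeasurableSet D) (hneg : ∀ t, -t ∈ D ↔ t ∈ D)
    (hadd : ∀ t, t + Real.pi / 2 ∈ D ↔ t ∈ D) :
    volume (Set.Ico 0 (2 * Real.pi) ∩ D) = 8 * volume (Set.Ioc 0 (Real.pi / 4) ∩ D) := by
  have hpi := Real.pi_pos
  have hquarter : volume (Set.Ioc 0 (Real.pi / 2) ∩ D) =
      2 * volume (Set.Ioc 0 (Real.pi / 4) ∩ D) := by
    rw [volume_Ioc_inter_split (b := Real.pi / 4) (by linarith) (by linarith) hD, two_mul]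
    congr 1
    -- The second octant is a quarter-turn of `(-π/4, 0]`, which mirrors the first octant.
    have h1 := volume_Ioc_inter_add (-(Real.pi / 4)) 0 hadd
    have h2 := volume_Ioc_inter_neg 0 (Real.pi / 4) hneg
    rw [neg_zero] at h2
    rw [← h2, ← h1]
    congr 3 <;> ring
  have hshift : ∀ m : ℕ, volume (Set.Ioc 0 (m * (Real.pi / 2)) ∩ D) =
      m * volume (Set.Ioc 0 (Real.pi / 2) ∩ D) := by
    intro m
    induction m with
    | zero => simp
    | succ m ih =>
      rw [volume_Ioc_inter_split (b := Real.pi / 2) (by linarith)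
        (by push_cast; nlinarith [Nat.cast_nonneg (α := ℝ) m]) hD]
      have := volume_Ioc_inter_add 0 (m * (Real.pi / 2)) hadd
      rw [zero_add] at this
      push_cast
      rw [add_mul (m : ℝ), one_mul, this, ih]
      ring
  have h4 := hshift 4
  rw [measure_congr (Ico_ae_eq_Ioc.inter (ae_eq_refl D)),
    show (2 : ℝ) * Real.pi = ((4 : ℕ) : ℝ) * (Real.pi / 2) by push_cast; ring, h4, hquarter,
    ← mul_assoc]
  norm_num

end Symmetry

/-- For a uniform angle `t`, the variable `min |tan t| |cot t|` is a Cauchy variable in absolute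
value, conditioned to be at most one. -/
theorem map_min_tan_cot_uniform :
    (cond (volume : Measure ℝ) (Set.Ico 0 (2 * Real.pi))).map
      (fun t => min |Real.tan t| |Real.cot t|) = truncatedCauchy := by
  have hpi := Real.pi_pos
  have habs : Measurable fun x : ℝ => |x| := by fun_prop
  have htr : ∀ E, MeasurableSet E → ((cauchyMeasure 0 1).map fun x => |x|) (Set.Iic 1 ∩ E) =
      ENNReal.ofReal Real.pi⁻¹ * (2 * volume (Set.Ioc 0 (Real.pi / 4) ∩
        (fun t => min |Real.tan t| |Real.cot t|) ⁻¹' E)) := by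
    intro E hE
    rw [Measure.map_apply habs (measurableSet_Iic.inter hE),
      cauchyMeasure_zero_one_apply (habs (measurableSet_Iic.inter hE))]
    rw [← volume_Icc_inter_eq_two_mul (measurable_min_tan_cot hE)
      (fun t => by simp only [Set.mem_preimage, min_tan_cot_neg]), arctan_image_abs_le_one]
  have hone : ((cauchyMeasure 0 1).map fun x => |x|) (Set.Iic 1) = 2⁻¹ := by
    have := htr Set.univ .univ
    simp only [Set.inter_univ, Set.preimage_univ, Real.volume_Ioc, sub_zero] at this
    rw [this, ← ENNReal.ofReal_ofNat, ← ENNReal.ofReal_mul (by positivity),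
      ← ENNReal.ofReal_mul (by positivity), ← ENNReal.ofReal_inv_of_pos (by positivity)]
    congr 1
    field_simp
    norm_num
  ext E hE
  rw [truncatedCauchy, cond_apply measurableSet_Iic, hone, htr E hE,
    Measure.map_apply measurable_min_tan_cot hE, cond_apply measurableSet_Ico,
    Real.volume_Ico, sub_zero]
  have := volume_Ico_inter_eq_eight_mul (measurable_min_tan_cot hE)
    (fun t => by simp only [Set.mem_preimage, min_tan_cot_neg])
    (fun t => by simp only [Set.mem_preimage, min_tan_cot_add_pi_div_two])
  -- Both sides are `4/π` times the measure in the first octant: `8/(2π)` for the angle and `2 ·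
  -- 2/π` for the conditioned Cauchy variable.
  rw [this, inv_inv, ← mul_assoc, ← mul_assoc, ← mul_assoc]
  congr 1
  rw [← ENNReal.ofReal_inv_of_pos (by positivity), ← ENNReal.ofReal_ofNat,
    ← ENNReal.ofReal_ofNat, ← ENNReal.ofReal_mul (by positivity),
    ← ENNReal.ofReal_mul (by positivity), ← ENNReal.ofReal_mul (by positivity)]
  congr 1
  field_simp
  norm_num

theorem cond_pi_eq_pi_cond (n : ℕ) {s : Set ℝ} (hs : MeasurableSet s) :
    cond (volume : Measure (Fin n → ℝ)) (Set.univ.pi fun _ => s) =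
      Measure.pi fun _ : Fin n => cond (volume : Measure ℝ) s := by
  symm
  have : IsFiniteMeasure (cond (volume : Measure ℝ) s) := inferInstance
  refine Measure.pi_eq fun t ht => ?_
  rw [cond_apply (MeasurableSet.univ_pi fun _ => hs), ← Set.pi_inter_distrib, volume_pi_pi,
    volume_pi_pi]
  simp only [cond_apply hs, Finset.prod_mul_distrib, Finset.prod_const, ENNReal.inv_pow]

section Uniform

variable {n : ℕ} {Ω : Type*} [MeasurableSpace Ω] {μ : Measure Ω} {θ : Ω → Fin n → ℝ}

theorem volume_cube_ne_zero : volume (Set.univ.pi fun _ : Fin n => Set.Ico 0 (2 * Real.pi)) ≠ 0 := by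
  rw [volume_pi_pi]
  simp [Real.pi_pos]

theorem volume_cube_ne_top : volume (Set.univ.pi fun _ : Fin n => Set.Ico 0 (2 * Real.pi)) ≠ ⊤ := by
  rw [volume_pi_pi]
  exact ENNReal.prod_ne_top fun _ _ => by rw [Real.volume_Ico]; exact ENNReal.ofReal_ne_top

theorem hasLaw_prod_min_tan_cot
    (hθ : pdf.IsUniform θ (Set.univ.pi fun _ => Set.Ico 0 (2 * Real.pi)) μ volume) :
    HasLaw (fun ω => ∏ j, (1 + min |Real.tan (θ ω j)| |Real.cot (θ ω j)| ^ 2))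
      (growthLaw n) μ := by
  have hm := hθ.aemeasurable volume_cube_ne_zero volume_cube_ne_top
  have : IsProbabilityMeasure (cond (volume : Measure ℝ) (Set.Ico 0 (2 * Real.pi))) :=
    cond_isProbabilityMeasure_of_finite (by simp [Real.pi_pos])
      (by rw [Real.volume_Ico]; exact ENNReal.ofReal_ne_top)
  have hcoord : Measurable fun (x : Fin n → ℝ) j => min |Real.tan (x j)| |Real.cot (x j)| :=
    measurable_pi_lambda _ fun j => measurable_min_tan_cot.comp (measurable_pi_apply j)
  have hprod : Measurable fun y : Fin n → ℝ => ∏ j, (1 + y j ^ 2) := by fun_prop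
  refine ⟨(hprod.comp hcoord).comp_aemeasurable hm, ?_⟩
  have h1 : μ.map (fun ω => ∏ j, (1 + min |Real.tan (θ ω j)| |Real.cot (θ ω j)| ^ 2)) =
      ((μ.map θ).map fun x j => min |Real.tan (x j)| |Real.cot (x j)|).map
        fun y => ∏ j, (1 + y j ^ 2) := by
    rw [Measure.map_map hprod hcoord, AEMeasurable.map_map_of_aemeasurable
      (hprod.comp hcoord).aemeasurable hm]
    rfl
  rw [h1, growthLaw, hθ, cond_pi_eq_pi_cond n measurableSet_Ico, Measure.pi_map_pi
    fun _ => measurable_min_tan_cot.aemeasurable, map_min_tan_cot_uniform]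

/-- By `sin_four_mul_eq`, the zeros of `sin (4 t)` are exactly the degenerate angles: `sin t = 0`,
`cos t = 0` or `|sin t| = |cos t|`. -/
theorem volume_sin_four_mul_eq_zero : volume {t : ℝ | Real.sin (4 * t) = 0} = 0 := by
  refine Set.Countable.measure_zero ?_ _
  refine (Set.countable_range fun m : ℤ => m * Real.pi / 4).mono ?_
  intro t ht
  obtain ⟨m, hm⟩ := Real.sin_eq_zero_iff.1 ht
  exact ⟨m, by simp only [hm]; ring⟩

theorem sin_four_mul_eq (t : ℝ) :
    Real.sin (4 * t) = 4 * Real.sin t * Real.cos t * (Real.cos t ^ 2 - Real.sin t ^ 2) := by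
  rw [show 4 * t = 2 * (2 * t) by ring, Real.sin_two_mul, Real.sin_two_mul, Real.cos_two_mul']
  ring

theorem ae_sin_cos_generic
    (hθ : pdf.IsUniform θ (Set.univ.pi fun _ => Set.Ico 0 (2 * Real.pi)) μ volume) :
    ∀ᵐ ω ∂μ, ∀ j, Real.sin (θ ω j) ≠ 0 ∧ Real.cos (θ ω j) ≠ 0 ∧
      |Real.sin (θ ω j)| ≠ |Real.cos (θ ω j)| := by
  have hm := hθ.aemeasurable volume_cube_ne_zero volume_cube_ne_top
  have hvol : ∀ᵐ x : Fin n → ℝ, ∀ j, Real.sin (4 * x j) ≠ 0 := by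
    rw [ae_all_iff]
    intro j
    have h : ∀ᵐ t : ℝ, Real.sin (4 * t) ≠ 0 := by
      rw [ae_iff]
      simpa using volume_sin_four_mul_eq_zero
    exact (Measure.tendsto_eval_ae_ae (μ := fun _ : Fin n => (volume : Measure ℝ))).eventually h
  filter_upwards [ae_of_ae_map hm (hθ.absolutelyContinuous.ae_le hvol)] with ω hω j
  have hω := hω j
  rw [sin_four_mul_eq] at hω
  refine ⟨fun h => hω ?_, fun h => hω ?_, fun h => hω ?_⟩
  · simp [h]
  · simp [h]
  · rw [sq_eq_sq_iff_abs_eq_abs _ _ |>.2 h.symm, sub_self, mul_zero]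

end Uniform

end Law

end Butterfly

end

theorem theorem2p6 (n : ℕ) :
    (∀ θ : Fin n → ℝ,
      (∀ j, Real.cos (θ j) ≠ 0) →
      (∀ j, |Real.tan (θ j)| ≤ 1) →
      (∀ i j, i ≤ j → |Real.tan (θ j)| ≤ |Real.tan (θ i)|) →
      (∀ s : Butterfly.Scheme,
        Butterfly.geFactorization s (Butterfly.butterfly n θ) =
          Butterfly.geFactorization .genp (Butterfly.butterfly n θ)) ∧
      (Butterfly.geFactorization .genp (Butterfly.butterfly n θ)).IsFactorizationOf
        (Butterfly.butterfly n θ) ∧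
      Butterfly.CompletelyPivoted (Butterfly.butterfly n θ) ∧
      (∀ s : Butterfly.Scheme,
        ENNReal.ofReal (Butterfly.growthFactor s (Butterfly.butterfly n θ)) =
          ∏ j, min (ENNReal.ofReal |Real.cos (θ j)|)⁻¹ (ENNReal.ofReal |Real.sin (θ j)|)⁻¹ ^ 2 ∧
        Butterfly.growthFactor s (Butterfly.butterfly n θ) =
          ∏ j, (1 + min |Real.tan (θ j)| |Real.cot (θ j)| ^ 2))) ∧
    (∀ {Ω : Type*} [MeasurableSpace Ω] (μ : MeasureTheory.Measure Ω)
      [MeasureTheory.IsProbabilityMeasure μ]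
      (θ : Ω → Fin n → ℝ) (σ : Ω → Equiv.Perm (Fin n)),
      MeasureTheory.pdf.IsUniform θ
        (Set.univ.pi fun _ => Set.Ico 0 (2 * Real.pi)) μ MeasureTheory.volume →
      (∀ᵐ ω ∂μ, ∀ i j, i ≤ j →
        min |Real.tan (θ ω (σ ω j))| |Real.cot (θ ω (σ ω j))| ≤
          min |Real.tan (θ ω (σ ω i))| |Real.cot (θ ω (σ ω i))|) →
      (∀ᵐ ω ∂μ,
        Butterfly.geFactorization .gepp (Butterfly.butterfly n (θ ω ∘ σ ω)) =
          Butterfly.geFactorization .gecp (Butterfly.butterfly n (θ ω ∘ σ ω)) ∧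
        Butterfly.geFactorization .gerp (Butterfly.butterfly n (θ ω ∘ σ ω)) =
          Butterfly.geFactorization .gecp (Butterfly.butterfly n (θ ω ∘ σ ω)) ∧
        (Butterfly.geFactorization .gecp (Butterfly.butterfly n (θ ω ∘ σ ω))).IsFactorizationOf
          (Butterfly.butterfly n (θ ω ∘ σ ω))) ∧
      (∀ s : Butterfly.Scheme, s ≠ .genp →
        ProbabilityTheory.HasLaw
          (fun ω => Butterfly.growthFactor s (Butterfly.butterfly n (θ ω ∘ σ ω)))
          (Butterfly.growthLaw n) μ)) := by
  refine ⟨fun θ hcos htan hanti => ?_, fun {Ω} _ μ _ θ σ hθ hσ => ?_⟩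
  · obtain ⟨h1, h2, h3, h4⟩ :=
      Butterfly.butterfly_completelyPivoted_and_growth hcos htan hanti
    refine ⟨h1, h2, h3, fun s => ⟨?_, ?_⟩⟩
    · rw [h4, ENNReal.ofReal_prod_of_nonneg fun j _ => by positivity]
      refine Finset.prod_congr rfl fun j _ => ?_
      have hle := Butterfly.abs_sin_le_abs_cos (hcos j) (htan j)
      -- In `ENNReal` the inverse of `0` is `⊤`, so `sin = 0` is not a special case.
      rw [min_eq_left (ENNReal.inv_le_inv.2 (ENNReal.ofReal_le_ofReal hle)),
        ← ENNReal.ofReal_inv_of_pos (abs_pos.2 (hcos j)),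
        ← ENNReal.ofReal_pow (by positivity), inv_pow, sq_abs]
    · rw [h4]
      refine Finset.prod_congr rfl fun j _ => ?_
      rw [Butterfly.inv_sq_eq_one_add_ratio_sq (Real.cos_sq_add_sin_sq (θ j)) (hcos j),
        Butterfly.min_tan_cot_of_le (hcos j)
          (Butterfly.abs_sin_le_abs_cos (hcos j) (htan j))]
  · have hae := (hσ.and (Butterfly.ae_sin_cos_generic hθ)).mono fun ω h =>
      Butterfly.butterfly_pivoting_and_growth (θ := θ ω ∘ σ ω) (fun j => (h.2 _).1)
        (fun j => (h.2 _).2.1) (fun j => (h.2 _).2.2) h.1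
    refine ⟨hae.mono fun ω h => ⟨h.1, h.2.1, h.2.2.1⟩, fun s hs => ?_⟩
    refine (Butterfly.hasLaw_prod_min_tan_cot hθ).congr (hae.mono fun ω h => ?_)
    simp only [h.2.2.2 s hs, Function.comp_apply]
    -- Reindexing by `σ ω` removes the sorting pointwise, so no measurability of `σ` is involved.
    exact Equiv.prod_comp (σ ω) fun j =>
      1 + min |Real.tan (θ ω j)| |Real.cot (θ ω j)| ^ 2
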